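/- Let $r\ge 1$ be an integer and $(X,\mu)$ a $\sigma$-finite measure space. A finite family $f_1,\dots,f_L$ of complex-valued functions in $L^{2r}(X,\mu)$ is said to satisfy Type IV superorthogonality (for $2r$-tuples) if $$\int_X f_{l_1}\overline{f_{l_2}}\cdots f_{l_{2r-1}}\overline{f_{l_{2r}}}\,d\mu=0\quad\text{whenever } l_1,\dots,l_{2r}\in\{1,\dots,L\}\text{ are all distinct.}$$ Call a real number $C$ admissible for $r$ if the direct inequality $$\Big\|\sum_{l=1}^L f_l\Big\|_{L^{2r}(X,\mu)}\le C\,\Big\|\Big(\sum_{l=1}^L|f_l|^2\Big)^{1/2}\Big\|_{L^{2r}(X,\mu)}$$ holds for all $\sigma$-finite measure spaces $(X,\mu)$, all $L$, and all families $f_1,\dots,f_L\in L^{2r}(X,\mu)$ satisfying Type IV superorthogonality for $2r$-tuples. Then: (1) for every integer $r\ge1$ there is an admissible constant $C_r$, depending only on $r$, with $C_r<4r$; (2) the order $O(r)$ is optimal: there is an absolute constant $c>0$ such that, for every integer $r\ge1$, every constant $C$ admissible for $r$ satisfies $C\ge c\,r$. -/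

import Mathlib

open MeasureTheory

universe u

/-- Type IV superorthogonality for `2r`-tuples of a finite family of complex-valued functions:
`∫ f_{l₁} conj(f_{l₂}) ⋯ f_{l_{2r-1}} conj(f_{l_{2r}}) dμ = 0` whenever `l₁, …, l_{2r}` are all
distinct. Positions are numbered from `0` here, so the even positions carry no conjugate. -/
def TypeIVSuperorthogonal {X : Type*} [MeasurableSpace X] (μ : Measure X) (r : ℕ) {L : ℕ}
    (f : Fin L → X → ℂ) : Prop :=
  ∀ l : Fin (2 * r) → Fin L, Function.Injective l →
    ∫ x, (∏ j : Fin (2 * r),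
      if Even (j : ℕ) then f (l j) x else (starRingEnd ℂ) (f (l j) x)) ∂μ = 0

/-- `C` is an admissible constant in the direct inequality with exponent `2r`: for every
`σ`-finite measure space and every finite family in `L^{2r}` with Type IV superorthogonality,
`‖∑ f_l‖_{2r} ≤ C ‖(∑ |f_l|²)^{1/2}‖_{2r}`. -/
def IsDirectConstant (r : ℕ) (C : ℝ) : Prop :=
  ∀ (X : Type u) [MeasurableSpace X] (μ : Measure X) [SigmaFinite μ] (L : ℕ)
    (f : Fin L → X → ℂ),
    (∀ l, MemLp (f l) ((2 * r : ℕ) : ENNReal) μ) →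
    TypeIVSuperorthogonal μ r f →
    eLpNorm (fun x => ∑ l, f l x) ((2 * r : ℕ) : ENNReal) μ ≤
      ENNReal.ofReal C *
        eLpNorm (fun x => Real.sqrt (∑ l, ‖f l x‖ ^ 2)) ((2 * r : ℕ) : ENNReal) μ

/-! Upper bound: write a = |∑ f_l| and s = (∑ |f_l|²)^{1/2} at a point, and n = 2r. Injectivity of
an index tuple is detected by a determinant; its Leibniz expansion turns the sum D over injective
tuples into a signed sum over permutations of the n positions (`sum_injective_prod_eq`). The
identity gives a^n. Any other σ factors over its cycles: fixed points give a, a k-cycle with k ≥ 2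
at most s^k. At most n^m permutations move exactly m points, so a^n ≤ Re D + ∑_{m=2}^n n^m a^{n-m}
s^m. Weighted AM-GM absorbs the powers of a (`exists_mul_norm_sum_pow_le`), and superorthogonality
gives ∫ D = 0.

Lower bound: on n(n+1) atoms, let f_l be -1 at the atom l and 1/n elsewhere. The products cancel
exactly, while ∑ f_l is about n and the square function stays at most 2. -/

/-! ### Expansion of injective sums over permutations -/

theorem det_ite_eq {α ι R : Type*} [Fintype α] [DecidableEq α] [DecidableEq ι] [CommRing R]
    (l : α → ι) [Decidable (Function.Injective l)] :
    (Matrix.of fun i j => if l i = l j then (1 : R) else 0).det =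
      if Function.Injective l then 1 else 0 := by
  split_ifs with h
  · rw [← Matrix.det_one (n := α)]
    congr 1
    ext i j
    simp [Matrix.one_apply, h.eq_iff]
  · simp only [Function.Injective, not_forall] at h
    obtain ⟨i, j, hij, hne⟩ := h
    refine Matrix.det_zero_of_row_eq hne ?_
    ext k
    simp [hij]

theorem sum_injective_prod_eq {α ι R : Type*} [Fintype α] [DecidableEq α] [DecidableEq ι] [Fintype ι] [CommRing R]
    (g : α → ι → R) :
    ∑ l : α → ι with Function.Injective l, ∏ j, g j (l j) =
      ∑ σ : Equiv.Perm α, (Equiv.Perm.sign σ : ℤ) *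
        ∑ l : α → ι with (∀ j, l (σ j) = l j), ∏ j, g j (l j) := by
  have key (l : α → ι) : (if Function.Injective l then (1 : R) else 0) =
      ∑ σ : Equiv.Perm α, ((Equiv.Perm.sign σ : ℤ) : R) *
        if ∀ j, l (σ j) = l j then 1 else 0 := by
    rw [← det_ite_eq, Matrix.det_apply']
    refine Finset.sum_congr rfl fun σ _ => ?_
    simp [Finset.prod_ite_zero]
  calc _ = ∑ l : α → ι, (if Function.Injective l then (1 : R) else 0) * ∏ j, g j (l j) := by
        simp [Finset.sum_filter]
    _ = _ := by
        simp_rw [key, Finset.sum_mul]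
        rw [Finset.sum_comm]
        refine Finset.sum_congr rfl fun σ _ => ?_
        rw [Finset.sum_filter, Finset.mul_sum]
        refine Finset.sum_congr rfl fun l _ => ?_
        split_ifs <;> simp

-- A tuple invariant under σ is constant on cycles, hence amounts to a free choice of one index per
-- cycle.
open Classical in
theorem sum_fixed_prod_eq {α ι R : Type*} [Fintype α] [DecidableEq α] [DecidableEq ι] [Fintype ι] [CommRing R]
    (σ : Equiv.Perm α) (g : α → ι → R) :
    ∑ l : α → ι with (∀ j, l (σ j) = l j), ∏ j, g j (l j) =
      ∏ q : Quotient (Equiv.Perm.SameCycle.setoid σ), ∑ i, ∏ j : α with ⟦j⟧ = q, g j i := by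
  have hrel {l : α → ι} (hl : ∀ j, l (σ j) = l j) {x y : α} (h : σ.SameCycle x y) :
      l x = l y := by
    obtain ⟨k, -, hk⟩ := h.exists_pow_eq'
    rw [← hk]
    clear hk
    induction k with
    | zero => simp
    | succ k ih => rw [pow_succ', Equiv.Perm.mul_apply, hl, ← ih]
  rw [Finset.prod_univ_sum, Fintype.piFinset_univ]
  symm
  refine Finset.sum_bij (fun h _ j => h ⟦j⟧) ?_ ?_ ?_ ?_
  · intro h _
    simp only [Finset.mem_filter, Finset.mem_univ, true_and]
    intro j
    congr 1
    exact Quotient.sound (Equiv.Perm.sameCycle_apply_left.2 (Equiv.Perm.SameCycle.refl σ j))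
  · intro h _ h' _ heq
    ext q
    induction q using Quotient.inductionOn with
    | h j => exact congrFun heq j
  · intro l hl
    simp only [Finset.mem_filter, Finset.mem_univ, true_and] at hl
    exact ⟨Quotient.lift l fun x y h => hrel hl h, Finset.mem_univ _, rfl⟩
  · intro h _
    rw [← Finset.prod_fiberwise (s := Finset.univ)
      (g := fun j : α => (⟦j⟧ : Quotient (Equiv.Perm.SameCycle.setoid σ)))]
    refine Finset.prod_congr rfl fun q _ => Finset.prod_congr rfl fun j hj => ?_
    simp only [Finset.mem_filter, Finset.mem_univ, true_and] at hj
    simp only [hj]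

/-- Each `b i` is at most the ℓ² norm, so k - 2 factors can be pulled out. This fails for k = 1,
which is why fixed points are treated apart from longer cycles. -/
theorem sum_pow_le_sqrt_pow {ι : Type*} [Fintype ι] (b : ι → ℝ) (hb : ∀ i, 0 ≤ b i) {k : ℕ}
    (hk : 2 ≤ k) : ∑ i, b i ^ k ≤ Real.sqrt (∑ i, b i ^ 2) ^ k := by
  obtain ⟨k, rfl⟩ := Nat.exists_eq_add_of_le hk
  have hle (i : ι) : b i ≤ Real.sqrt (∑ i, b i ^ 2) :=
    Real.le_sqrt_of_sq_le (Finset.single_le_sum (f := fun i => b i ^ 2)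
      (fun i _ => sq_nonneg _) (Finset.mem_univ i))
  rw [pow_add, Real.sq_sqrt (Finset.sum_nonneg fun i _ => sq_nonneg _), Finset.sum_mul]
  refine Finset.sum_le_sum fun i _ => ?_
  rw [pow_add]
  gcongr
  · exact hb i
  · exact hle i

open Classical in
theorem norm_sum_fixed_prod_le {α ι : Type*} [Fintype α] [DecidableEq α] [DecidableEq ι] [Fintype ι]
    (σ : Equiv.Perm α) (g : α → ι → ℂ) (b : ι → ℝ) (a : ℝ) (hgb : ∀ j i, ‖g j i‖ = b i)
    (hga : ∀ j, ‖∑ i, g j i‖ = a) (hb : ∀ i, 0 ≤ b i) :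
    ‖∑ l : α → ι with (∀ j, l (σ j) = l j), ∏ j, g j (l j)‖ ≤
      ∏ j, if σ j = j then a else Real.sqrt (∑ i, b i ^ 2) := by
  rw [sum_fixed_prod_eq, norm_prod,
    ← Finset.prod_fiberwise (s := Finset.univ)
      (g := fun j : α => (⟦j⟧ : Quotient (Equiv.Perm.SameCycle.setoid σ)))]
  refine Finset.prod_le_prod (fun _ _ => norm_nonneg _) fun q _ => ?_
  induction q using Quotient.inductionOn with
  | h x =>
  have hmem (j : α) : (⟦j⟧ : Quotient (Equiv.Perm.SameCycle.setoid σ)) = ⟦x⟧ ↔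
      σ.SameCycle j x := Quotient.eq
  simp only [hmem]
  by_cases hx : σ x = x
  · have : ({j | σ.SameCycle j x} : Finset α) = {x} := by
      ext j
      simp only [Finset.mem_filter, Finset.mem_univ, true_and, Finset.mem_singleton]
      refine ⟨fun h => (h.symm.eq_of_left hx).symm, ?_⟩
      rintro rfl
      exact Equiv.Perm.SameCycle.refl σ j
    rw [this]
    simp [hx, hga]
  · rw [Finset.prod_congr rfl (g := fun _ => Real.sqrt (∑ i, b i ^ 2)), Finset.prod_const]
    · refine (norm_sum_le _ _).trans ?_
      simp only [norm_prod, hgb, Finset.prod_const]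
      refine sum_pow_le_sqrt_pow b hb ?_
      refine Finset.one_lt_card.2 ⟨x, ?_, σ x, ?_, fun h => hx h.symm⟩
      · simp [Equiv.Perm.SameCycle.refl]
      · simp [Equiv.Perm.SameCycle.refl]
    · intro j hj
      simp only [Finset.mem_filter, Finset.mem_univ, true_and] at hj
      rw [if_neg]
      intro h
      exact hx ((hj.apply_eq_self_iff).1 h)

/-! ### Counting permutations by support -/

theorem card_perm_support_eq_le {α : Type*} [Fintype α] [DecidableEq α] (T : Finset α) :
    (Finset.univ.filter fun σ : Equiv.Perm α => σ.support = T).card ≤ T.card.factorial := by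
  have h := Fintype.card_congr (Equiv.Perm.subtypeEquivSubtypePerm (fun a => a ∈ T))
  rw [Fintype.card_perm, Fintype.card_coe, Fintype.card_subtype] at h
  rw [h]
  refine Finset.card_le_card fun σ hσ => ?_
  simp only [Finset.mem_filter, Finset.mem_univ, true_and] at hσ ⊢
  intro a ha
  rw [← hσ] at ha
  simpa using ha

theorem sum_perm_ne_one_le {n : ℕ} {a s : ℝ} (ha : 0 ≤ a) (hs : 0 ≤ s) :
    ∑ σ : Equiv.Perm (Fin n) with σ ≠ 1, ∏ j, (if σ j = j then a else s) ≤
      ∑ m ∈ Finset.Icc 2 n, (n : ℝ) ^ m * (a ^ (n - m) * s ^ m) := by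
  have hprod (σ : Equiv.Perm (Fin n)) : ∏ j, (if σ j = j then a else s) =
      a ^ (n - σ.support.card) * s ^ σ.support.card := by
    rw [Finset.prod_ite, Finset.prod_const, Finset.prod_const]
    have h2 : (Finset.univ.filter fun j => ¬ σ j = j) = σ.support := by ext; simp
    have h1 : (Finset.univ.filter fun j => σ j = j) = (σ.support)ᶜ := by ext; simp
    rw [h1, h2, Finset.card_compl, Fintype.card_fin]
  simp only [hprod]
  -- Sizes below 2 get weight zero: a nonidentity permutation moves at least two points.
  let F : ℕ → ℝ := fun m => if 2 ≤ m then (m.factorial : ℝ) * (a ^ (n - m) * s ^ m) else 0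
  calc _ = ∑ T : Finset (Fin n), ∑ σ : Equiv.Perm (Fin n) with (σ ≠ 1 ∧ σ.support = T),
          a ^ (n - σ.support.card) * s ^ σ.support.card := by
        rw [← Finset.sum_fiberwise (s := Finset.univ.filter fun σ : Equiv.Perm (Fin n) => σ ≠ 1)
          (g := fun σ => σ.support)]
        simp only [Finset.filter_filter]
    _ ≤ ∑ T : Finset (Fin n), F T.card := by
        refine Finset.sum_le_sum fun T _ => ?_
        simp only [F]
        split_ifs with hT
        · rw [Finset.sum_congr rfl (g := fun _ => a ^ (n - T.card) * s ^ T.card),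
            Finset.sum_const, nsmul_eq_mul]
          · gcongr
            refine le_trans (Finset.card_le_card ?_) (card_perm_support_eq_le T)
            exact Finset.monotone_filter_right _ fun σ _ h => h.2
          · intro σ hσ
            simp only [Finset.mem_filter] at hσ
            rw [hσ.2.2]
        · refine (Finset.sum_eq_zero fun σ hσ => ?_).le
          simp only [Finset.mem_filter, Finset.mem_univ, true_and] at hσ
          refine absurd ?_ hT
          rw [← hσ.2]
          exact Equiv.Perm.two_le_card_support_of_ne_one hσ.1
    _ = ∑ m ∈ Finset.range (n + 1), n.choose m • F m := by
        rw [← Finset.powerset_univ, Finset.sum_powerset_apply_card, Finset.card_univ,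
          Fintype.card_fin]
    _ = ∑ m ∈ Finset.Icc 2 n, n.choose m • F m := by
        symm
        refine Finset.sum_subset (fun m hm => ?_) fun m hm hm' => ?_
        · simp only [Finset.mem_Icc, Finset.mem_range] at hm ⊢
          omega
        · simp only [Finset.mem_Icc, Finset.mem_range] at hm hm'
          simp only [F]
          rw [if_neg (by omega), smul_zero]
    _ ≤ _ := by
        refine Finset.sum_le_sum fun m hm => ?_
        simp only [F]
        rw [if_pos (Finset.mem_Icc.1 hm).1, nsmul_eq_mul, ← mul_assoc]
        gcongr
        -- The choice of support and the permutation on it together cost C(n,m) m! ≤ n^m.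
        rw [mul_comm]
        exact_mod_cast (Nat.descFactorial_eq_factorial_mul_choose n m).symm.trans_le
          (Nat.descFactorial_le_pow n m)

/-! ### The pointwise inequality -/

theorem pow_sub_mul_pow_le {n m : ℕ} (hm : m ≤ n) (hn : 0 < n) {a t : ℝ} (ha : 0 ≤ a)
    (ht : 0 ≤ t) : a ^ (n - m) * t ^ m ≤ (1 - (m : ℝ) / n) * a ^ n + (m : ℝ) / n * t ^ n := by
  have hn' : (0 : ℝ) < n := by exact_mod_cast hn
  have h := Real.geom_mean_le_arith_mean2_weighted (w₁ := 1 - (m : ℝ) / n) (w₂ := (m : ℝ) / n)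
    (p₁ := a ^ n) (p₂ := t ^ n)
    (by rw [sub_nonneg, div_le_one hn']; exact_mod_cast hm) (by positivity) (by positivity)
    (by positivity) (by ring)
  refine le_trans (le_of_eq ?_) h
  rw [← Real.rpow_natCast a n, ← Real.rpow_natCast t n, ← Real.rpow_mul ha, ← Real.rpow_mul ht,
    ← Real.rpow_natCast a, ← Real.rpow_natCast t, Nat.cast_sub hm]
  congr 2 <;> field_simp

theorem sum_Icc_two_pow_le_one {n : ℕ} (hn : 1 ≤ n) :
    ∑ m ∈ Finset.Icc 2 n, (4 / 7 : ℝ) ^ m ≤ 1 := by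
  have h : ∑ m ∈ Finset.Icc 2 n, (4 / 7 : ℝ) ^ m = 4 / 3 * (4 / 7 - (4 / 7) ^ n) := by
    induction n, hn using Nat.le_induction with
    | base => simp
    | succ k hk ih =>
      rw [Finset.sum_Icc_succ_top (by omega), ih]
      ring
  rw [h]
  have : (0 : ℝ) ≤ (4 / 7) ^ n := by positivity
  linarith

/-- The terms with injective indices in the expansion of `(∑ z) (∑ z̄) (∑ z) ⋯ (∑ z̄)`. -/
noncomputable def injectiveSum (r : ℕ) {L : ℕ} (z : Fin L → ℂ) : ℂ :=
  ∑ l : Fin (2 * r) → Fin L with Function.Injective l,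
    ∏ j : Fin (2 * r), if Even (j : ℕ) then z (l j) else (starRingEnd ℂ) (z (l j))

theorem prod_ite_even_conj (r : ℕ) (w : ℂ) :
    ∏ j : Fin (2 * r), (if Even (j : ℕ) then w else (starRingEnd ℂ) w) =
      ((‖w‖ ^ (2 * r) : ℝ) : ℂ) := by
  rw [Fin.prod_univ_eq_prod_range
    (fun j : ℕ => if Even j then w else (starRingEnd ℂ) w) (2 * r)]
  induction r with
  | zero => simp
  | succ r ih =>
    rw [mul_add, mul_one, Finset.prod_range_succ, Finset.prod_range_succ, ih]
    simp only [even_two, Even.mul_right, if_true, Nat.not_even_bit1, if_false, pow_add]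
    rw [mul_assoc, Complex.mul_conj']
    push_cast
    rfl

theorem norm_sum_pow_le_injectiveSum (r : ℕ) {L : ℕ} (z : Fin L → ℂ) :
    ‖∑ i, z i‖ ^ (2 * r) ≤ (injectiveSum r z).re +
      ∑ m ∈ Finset.Icc 2 (2 * r), ((2 * r : ℕ) : ℝ) ^ m *
        (‖∑ i, z i‖ ^ (2 * r - m) * Real.sqrt (∑ i, ‖z i‖ ^ 2) ^ m) := by
  let g : Fin (2 * r) → Fin L → ℂ := fun j i =>
    if Even (j : ℕ) then z i else (starRingEnd ℂ) (z i)
  have hgb (j : Fin (2 * r)) (i : Fin L) : ‖g j i‖ = ‖z i‖ := by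
    simp only [g]
    split_ifs <;> simp
  have hgs (j : Fin (2 * r)) : ∑ i, g j i =
      if Even (j : ℕ) then ∑ i, z i else (starRingEnd ℂ) (∑ i, z i) := by
    simp only [g]
    split_ifs <;> simp
  have hga (j : Fin (2 * r)) : ‖∑ i, g j i‖ = ‖∑ i, z i‖ := by
    rw [hgs]
    split_ifs
    · rfl
    · exact RCLike.norm_conj _
  have hone : ∑ l : Fin (2 * r) → Fin L, ∏ j, g j (l j) =
      ((‖∑ i, z i‖ ^ (2 * r) : ℝ) : ℂ) := by
    rw [← prod_ite_even_conj, ← Finset.prod_congr rfl fun j _ => hgs j, Finset.prod_univ_sum,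
      Fintype.piFinset_univ]
  have hD : injectiveSum r z = ((‖∑ i, z i‖ ^ (2 * r) : ℝ) : ℂ) +
      ∑ σ : Equiv.Perm (Fin (2 * r)) with σ ≠ 1, (Equiv.Perm.sign σ : ℤ) *
        ∑ l : Fin (2 * r) → Fin L with (∀ j, l (σ j) = l j), ∏ j, g j (l j) := by
    rw [Finset.filter_ne', ← hone]
    refine (sum_injective_prod_eq g).trans ?_
    rw [← Finset.add_sum_erase _ _ (Finset.mem_univ 1)]
    simp only [Equiv.Perm.sign_one, Equiv.Perm.one_apply, implies_true, Finset.filter_true,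
      Units.val_one, Int.cast_one, one_mul]
    congr!
  have hE : ‖((‖∑ i, z i‖ ^ (2 * r) : ℝ) : ℂ) - injectiveSum r z‖ ≤
      ∑ m ∈ Finset.Icc 2 (2 * r), ((2 * r : ℕ) : ℝ) ^ m *
        (‖∑ i, z i‖ ^ (2 * r - m) * Real.sqrt (∑ i, ‖z i‖ ^ 2) ^ m) := by
    rw [hD, sub_add_cancel_left, norm_neg]
    refine (norm_sum_le _ _).trans (le_trans (Finset.sum_le_sum fun σ _ => ?_)
      (sum_perm_ne_one_le (norm_nonneg _) (Real.sqrt_nonneg _)))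
    rw [norm_mul]
    refine le_trans (le_of_eq ?_)
      (norm_sum_fixed_prod_le σ g (fun i => ‖z i‖) _ hgb hga fun _ => norm_nonneg _)
    rcases Int.units_eq_one_or (Equiv.Perm.sign σ) with h | h <;> simp only [h] <;>
      simp only [Units.val_one, Units.val_neg, Int.cast_neg, Int.cast_one, norm_neg, norm_one,
        one_mul] <;> congr!
  have h := (Complex.re_le_norm _).trans hE
  rw [Complex.sub_re, Complex.ofReal_re] at h
  linarith

/-- With t = (7/2) r s one has (2r s)^m = (4/7)^m t^m. After AM-GM the coefficient of a^{2r} is W -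
θ, where W = ∑ (4/7)^m ≤ 1 and θ is the same sum weighted by m/(2r). Exactly θ a^{2r} survives on
the left against θ t^{2r}, so θ cancels after integration. -/
theorem exists_mul_norm_sum_pow_le {r : ℕ} (hr : 1 ≤ r) : ∃ θ : ℝ, 0 < θ ∧
    ∀ {L : ℕ} (z : Fin L → ℂ), θ * ‖∑ i, z i‖ ^ (2 * r) ≤ (injectiveSum r z).re +
      θ * (7 / 2 * r * Real.sqrt (∑ i, ‖z i‖ ^ 2)) ^ (2 * r) := by
  have hr' : (1 : ℝ) ≤ r := by exact_mod_cast hr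
  refine ⟨∑ m ∈ Finset.Icc 2 (2 * r), (4 / 7 : ℝ) ^ m * ((m : ℝ) / (2 * r : ℕ)), ?_,
    fun {L} z => ?_⟩
  · refine Finset.sum_pos (fun m hm => ?_) ⟨2, Finset.mem_Icc.2 ⟨le_rfl, by omega⟩⟩
    have : 0 < m := by have := (Finset.mem_Icc.1 hm).1; omega
    positivity
  · have h := norm_sum_pow_le_injectiveSum r z
    set a := ‖∑ i, z i‖
    set s := Real.sqrt (∑ i, ‖z i‖ ^ 2)
    have ha : 0 ≤ a := norm_nonneg _
    have hs : 0 ≤ s := Real.sqrt_nonneg _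
    have hE : ∑ m ∈ Finset.Icc 2 (2 * r), ((2 * r : ℕ) : ℝ) ^ m * (a ^ (2 * r - m) * s ^ m) ≤
        ∑ m ∈ Finset.Icc 2 (2 * r), (4 / 7 : ℝ) ^ m *
          ((1 - (m : ℝ) / (2 * r : ℕ)) * a ^ (2 * r) +
            (m : ℝ) / (2 * r : ℕ) * (7 / 2 * r * s) ^ (2 * r)) := by
      refine Finset.sum_le_sum fun m hm => ?_
      have hy := pow_sub_mul_pow_le (Finset.mem_Icc.1 hm).2 (by omega) ha
        (by positivity : 0 ≤ 7 / 2 * (r : ℝ) * s)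
      refine le_trans (le_of_eq ?_) (mul_le_mul_of_nonneg_left hy (by positivity))
      rw [mul_left_comm, mul_left_comm ((4 / 7 : ℝ) ^ m), ← mul_pow, ← mul_pow]
      push_cast
      congr 2
      ring
    have hW := mul_le_mul_of_nonneg_right (sum_Icc_two_pow_le_one (n := 2 * r) (by omega))
      (by positivity : 0 ≤ a ^ (2 * r))
    have hsplit : ∑ m ∈ Finset.Icc 2 (2 * r), (4 / 7 : ℝ) ^ m *
          ((1 - (m : ℝ) / (2 * r : ℕ)) * a ^ (2 * r) +
            (m : ℝ) / (2 * r : ℕ) * (7 / 2 * r * s) ^ (2 * r)) =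
        (∑ m ∈ Finset.Icc 2 (2 * r), (4 / 7 : ℝ) ^ m) * a ^ (2 * r) -
        (∑ m ∈ Finset.Icc 2 (2 * r), (4 / 7 : ℝ) ^ m * ((m : ℝ) / (2 * r : ℕ))) * a ^ (2 * r) +
        (∑ m ∈ Finset.Icc 2 (2 * r), (4 / 7 : ℝ) ^ m * ((m : ℝ) / (2 * r : ℕ))) *
          (7 / 2 * r * s) ^ (2 * r) := by
      simp only [Finset.sum_mul]
      rw [← Finset.sum_sub_distrib, ← Finset.sum_add_distrib]
      refine Finset.sum_congr rfl fun m _ => ?_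
      ring
    linarith

/-! ### Integration and the direct inequality -/

theorem norm_le_sqrt_sum {L : ℕ} (z : Fin L → ℂ) (i : Fin L) :
    ‖z i‖ ≤ Real.sqrt (∑ i, ‖z i‖ ^ 2) :=
  Real.le_sqrt_of_sq_le (Finset.single_le_sum (f := fun i => ‖z i‖ ^ 2)
    (fun _ _ => sq_nonneg _) (Finset.mem_univ i))

theorem sqrt_sum_le_sum_norm {L : ℕ} (z : Fin L → ℂ) :
    Real.sqrt (∑ i, ‖z i‖ ^ 2) ≤ ∑ i, ‖z i‖ := by
  refine Real.sqrt_le_iff.2 ⟨Finset.sum_nonneg fun _ _ => norm_nonneg _, ?_⟩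
  exact Finset.sum_sq_le_sq_sum_of_nonneg fun i _ => norm_nonneg _

theorem memLp_sqrt_sum {X : Type*} [MeasurableSpace X] {μ : Measure X} {p : ENNReal} {L : ℕ}
    {f : Fin L → X → ℂ} (hf : ∀ l, MemLp (f l) p μ) :
    MemLp (fun x => Real.sqrt (∑ l, ‖f l x‖ ^ 2)) p μ := by
  refine (memLp_finsetSum Finset.univ fun l _ => (hf l).norm).mono ?_
    (Filter.Eventually.of_forall fun x => ?_)
  · refine Real.continuous_sqrt.comp_aestronglyMeasurable ?_
    exact Finset.aestronglyMeasurable_fun_sum _ fun l _ => (hf l).1.norm.pow 2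
  · rw [Real.norm_of_nonneg (Real.sqrt_nonneg _)]
    exact (sqrt_sum_le_sum_norm fun l => f l x).trans (le_abs_self _)

theorem eLpNorm_le_of_integral_pow_le {X E F : Type*} [MeasurableSpace X] {μ : Measure X}
    [NormedAddCommGroup E] [NormedAddCommGroup F] {n : ℕ} (hn : n ≠ 0) {f : X → E} {g : X → F}
    (hf : MemLp f n μ) (hg : MemLp g n μ)
    (h : ∫ x, ‖f x‖ ^ n ∂μ ≤ ∫ x, ‖g x‖ ^ n ∂μ) : eLpNorm f n μ ≤ eLpNorm g n μ := by
  have hn' : (n : ENNReal) ≠ 0 := by exact_mod_cast hn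
  rw [hf.eLpNorm_eq_integral_rpow_norm hn' (ENNReal.natCast_ne_top n),
    hg.eLpNorm_eq_integral_rpow_norm hn' (ENNReal.natCast_ne_top n)]
  simp only [ENNReal.toReal_natCast, Real.rpow_natCast]
  refine ENNReal.ofReal_le_ofReal (Real.rpow_le_rpow ?_ h (by positivity))
  exact integral_nonneg fun x => by positivity

/-- Every factor is at most the square function, whose power 2r is integrable. -/
theorem integrable_prod_conj {X : Type*} [MeasurableSpace X] {μ : Measure X} {r : ℕ}
    (hr : 1 ≤ r) {L : ℕ} {f : Fin L → X → ℂ} (hf : ∀ l, MemLp (f l) ((2 * r : ℕ) : ENNReal) μ)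
    (l : Fin (2 * r) → Fin L) :
    Integrable (fun x => ∏ j : Fin (2 * r),
      if Even (j : ℕ) then f (l j) x else (starRingEnd ℂ) (f (l j) x)) μ := by
  refine ((memLp_sqrt_sum hf).integrable_norm_pow (by omega)).mono' ?_
    (Filter.Eventually.of_forall fun x => ?_)
  · refine Finset.aestronglyMeasurable_fun_prod _ fun j _ => ?_
    split_ifs
    · exact (hf _).1
    · exact Complex.continuous_conj.comp_aestronglyMeasurable (hf _).1
  · rw [norm_prod, Real.norm_of_nonneg (Real.sqrt_nonneg _)]
    refine (Finset.prod_le_prod (fun _ _ => norm_nonneg _)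
      (g := fun _ => Real.sqrt (∑ l, ‖f l x‖ ^ 2)) fun j _ => ?_).trans_eq (by simp)
    refine le_trans (le_of_eq ?_) (norm_le_sqrt_sum (fun l => f l x) (l j))
    split_ifs <;> simp

theorem isDirectConstant_seven_halves {r : ℕ} (hr : 1 ≤ r) :
    IsDirectConstant.{u} r (7 / 2 * r) := by
  intro X _ μ _ L f hf hortho
  have hp : 2 * r ≠ 0 := by omega
  have hS := memLp_sqrt_sum hf
  have hA : MemLp (fun x => ∑ l, f l x) ((2 * r : ℕ) : ENNReal) μ :=
    memLp_finsetSum Finset.univ fun l _ => hf l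
  have hCS := hS.const_mul (7 / 2 * r : ℝ)
  have hscale : eLpNorm (fun x => 7 / 2 * (r : ℝ) * Real.sqrt (∑ l, ‖f l x‖ ^ 2))
      ((2 * r : ℕ) : ENNReal) μ = ENNReal.ofReal (7 / 2 * r) *
        eLpNorm (fun x => Real.sqrt (∑ l, ‖f l x‖ ^ 2)) ((2 * r : ℕ) : ENNReal) μ := by
    rw [← Real.enorm_eq_ofReal (by positivity), ← eLpNorm_const_smul]
    rfl
  rw [← hscale]
  refine eLpNorm_le_of_integral_pow_le hp hA hCS ?_
  have hIA := hA.integrable_norm_pow hp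
  have hICS := hCS.integrable_norm_pow hp
  have hID : Integrable (fun x => injectiveSum r fun l => f l x) μ :=
    integrable_finsetSum _ fun l _ => integrable_prod_conj hr hf l
  have hD : ∫ x, (injectiveSum r fun l => f l x).re ∂μ = 0 := by
    have h0 : ∫ x, injectiveSum r (fun l => f l x) ∂μ = 0 := by
      simp only [injectiveSum]
      rw [integral_finsetSum _ fun l _ => integrable_prod_conj hr hf l]
      exact Finset.sum_eq_zero fun l hl => hortho l (Finset.mem_filter.1 hl).2
    have := integral_re hID
    rw [h0] at this
    simpa using this
  obtain ⟨θ, hθ, hpt⟩ := exists_mul_norm_sum_pow_le hr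
  have hint := integral_mono (hIA.const_mul θ) (hID.re.add (hICS.const_mul θ)) fun x => by
    have := hpt fun l => f l x
    rw [← Real.norm_of_nonneg (by positivity :
      0 ≤ 7 / 2 * (r : ℝ) * Real.sqrt (∑ l, ‖f l x‖ ^ 2))] at this
    exact this
  simp only [Pi.add_apply] at hint
  rw [integral_add hID.re (hICS.const_mul θ), integral_const_mul, integral_const_mul] at hint
  have hD' : ∫ x, RCLike.re (injectiveSum r fun l => f l x) ∂μ = 0 := hD
  rw [hD', zero_add] at hint
  exact le_of_mul_le_mul_left hint hθ

/-! ### The extremal example -/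

/-- The n points hit by `l` contribute -k^{1-n} each, the other nk points k^{-n} each; M is chosen
so that these balance. -/
theorem sum_prod_ite_eq_zero {n k M : ℕ} (hk : 0 < k) (hM : M = n * (k + 1))
    (l : Fin n → Fin M) (hl : Function.Injective l) :
    ∑ x : Fin M, ∏ j, (if x = l j then (-1 : ℂ) else 1 / k) = 0 := by
  have hk' : (k : ℂ) ≠ 0 := by exact_mod_cast hk.ne'
  have hin (i : Fin n) : ∏ j, (if l i = l j then (-1 : ℂ) else 1 / k) =
      -(1 / k : ℂ) ^ (n - 1) := by
    simp only [hl.eq_iff]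
    rw [← Finset.mul_prod_erase _ _ (Finset.mem_univ i),
      Finset.prod_congr rfl (g := fun _ => (1 / k : ℂ)), Finset.prod_const,
      Finset.card_erase_of_mem (Finset.mem_univ i)]
    · simp
    · intro j hj
      rw [if_neg (Finset.ne_of_mem_erase hj).symm]
  have hout (x : Fin M) (hx : x ∈ (Finset.univ.image l)ᶜ) :
      ∏ j, (if x = l j then (-1 : ℂ) else 1 / k) = (1 / k : ℂ) ^ n := by
    rw [Finset.prod_congr rfl (g := fun _ => (1 / k : ℂ)), Finset.prod_const]
    · simp
    · intro j _
      rw [if_neg]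
      rintro rfl
      simp at hx
  rw [← Finset.sum_add_sum_compl (Finset.univ.image l), Finset.sum_congr rfl hout,
    Finset.sum_image hl.injOn, Finset.sum_congr rfl fun i _ => hin i, Finset.sum_const,
    Finset.sum_const, Finset.card_compl, Finset.card_image_of_injective _ hl]
  simp only [Finset.card_univ, Fintype.card_fin, nsmul_eq_mul]
  have : M - n = n * k := by rw [hM, mul_add, mul_one, Nat.add_sub_cancel]
  rw [this]
  rcases n with _ | n
  · simp
  · rw [Nat.add_sub_cancel, pow_succ]
    push_cast
    field_simp
    ring

theorem sum_ite_eq_of_card {M : ℕ} {R : Type*} [CommRing R] (x : Fin M) (a b : R) :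
    ∑ l : Fin M, (if x = l then a else b) = a + (M - 1 : R) * b := by
  have h (l : Fin M) : (if x = l then a else b) = (if x = l then a - b else 0) + b := by
    split_ifs <;> simp
  simp only [h, Finset.sum_add_distrib, Finset.sum_ite_eq, Finset.mem_univ, if_true,
    Finset.sum_const, Finset.card_univ, Fintype.card_fin, nsmul_eq_mul]
  ring

theorem half_mul_le_of_isDirectConstant {r : ℕ} (hr : 1 ≤ r) {C : ℝ}
    (hC : IsDirectConstant.{u} r C) : 1 / 2 * (r : ℝ) ≤ C := by
  have hr' : (1 : ℝ) ≤ r := by exact_mod_cast hr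
  obtain ⟨M, hM⟩ : ∃ M : ℕ, M = 2 * r * (2 * r + 1) := ⟨_, rfl⟩
  have hMr : (M : ℝ) = 2 * r * (2 * r + 1) := by rw [hM]; push_cast; ring
  let _ : MeasurableSpace (ULift.{u} (Fin M)) := ⊤
  have : MeasurableSingletonClass (ULift.{u} (Fin M)) := ⟨fun _ => trivial⟩
  have : Nonempty (ULift.{u} (Fin M)) :=
    ⟨⟨⟨0, by rw [hM]; positivity⟩⟩⟩
  let μ : Measure (ULift.{u} (Fin M)) := Measure.count
  let f : Fin M → ULift.{u} (Fin M) → ℂ := fun l x => if x.down = l then -1 else 1 / (2 * r : ℕ)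
  have hconj (l : Fin M) (x : ULift.{u} (Fin M)) : (starRingEnd ℂ) (f l x) = f l x := by
    simp only [f]
    split_ifs
    · simp
    · rw [map_div₀, map_one, map_natCast]
  have hmem (l : Fin M) : MemLp (f l) ((2 * r : ℕ) : ENNReal) μ := MemLp.of_discrete
  have hortho : TypeIVSuperorthogonal μ r f := by
    intro l hl
    simp only [hconj, ite_self, μ, f]
    rw [integral_count]
    rw [← sum_prod_ite_eq_zero (n := 2 * r) (k := 2 * r) (by omega) hM l hl]
    exact Fintype.sum_equiv Equiv.ulift _ _ fun x => rfl
  have h := hC (ULift.{u} (Fin M)) μ M f hmem hortho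
  have hp : ((2 * r : ℕ) : ENNReal) ≠ 0 := by
    exact_mod_cast (by omega : 2 * r ≠ 0)
  have hμ : μ ≠ 0 := by
    rw [← Measure.measure_univ_ne_zero]
    exact Measure.count_ne_zero Set.univ_nonempty
  have hsum (x : ULift.{u} (Fin M)) :
      ∑ l, f l x = ((-1 + (M - 1) * (1 / (2 * r)) : ℝ) : ℂ) := by
    simp only [f]
    rw [sum_ite_eq_of_card]
    push_cast
    ring
  have hsq (x : ULift.{u} (Fin M)) :
      ∑ l, ‖f l x‖ ^ 2 = 1 + (M - 1) * (1 / (2 * r)) ^ 2 := by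
    rw [← sum_ite_eq_of_card x.down]
    refine Finset.sum_congr rfl fun l _ => ?_
    simp only [f]
    split_ifs <;> simp
  simp only [hsum, hsq] at h
  rw [eLpNorm_const _ hp hμ, eLpNorm_const _ hp hμ, ← mul_assoc,
    ENNReal.mul_le_mul_iff_left, Real.enorm_eq_ofReal (Real.sqrt_nonneg _),
    ← ofReal_norm, Complex.norm_real, Real.norm_eq_abs] at h
  · rw [← ENNReal.ofReal_mul' (Real.sqrt_nonneg _)] at h
    have hMk : ((M : ℝ) - 1) * (1 / (2 * r)) = 2 * r + 1 - 1 / (2 * r) := by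
      rw [hMr]
      field_simp
    have hk1 : 1 / (2 * r : ℝ) ≤ 1 / 2 := one_div_le_one_div_of_le (by norm_num) (by linarith)
    have hk0 : 0 < 1 / (2 * r : ℝ) := by positivity
    -- The sum equals 2r - 1/(2r).
    have hA : (r : ℝ) ≤ |-1 + (M - 1) * (1 / (2 * r) : ℝ)| := by
      refine le_trans ?_ (le_abs_self _)
      rw [hMk]
      linarith
    have hS : Real.sqrt (1 + (M - 1) * (1 / (2 * r)) ^ 2) ≤ 2 := by
      rw [Real.sqrt_le_left (by norm_num), sq (1 / (2 * r : ℝ)), ← mul_assoc, hMk]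
      have : (2 * r : ℝ) * (1 / (2 * r)) = 1 := by field_simp
      nlinarith
    -- For negative C, `ENNReal.ofReal` truncates the right side to 0, contradicting `hA`.
    rcases le_or_gt 0 C with h0 | h0
    · rw [ENNReal.ofReal_le_ofReal_iff (by positivity)] at h
      have := mul_le_mul_of_nonneg_left hS h0
      linarith
    · rw [ENNReal.ofReal_of_nonpos
        (mul_nonpos_of_nonpos_of_nonneg h0.le (Real.sqrt_nonneg _)), nonpos_iff_eq_zero,
        ENNReal.ofReal_eq_zero] at h
      linarith
  · simp [hμ]
  · simp [μ, Measure.count_apply]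

theorem mainTheorem4 :
    (∃ C : ℕ → ℝ, ∀ r : ℕ, 1 ≤ r → C r < 4 * (r : ℝ) ∧ IsDirectConstant.{u} r (C r)) ∧
    (∃ c : ℝ, 0 < c ∧ ∀ r : ℕ, 1 ≤ r → ∀ C : ℝ, IsDirectConstant.{u} r C → c * (r : ℝ) ≤ C) := by
  refine ⟨⟨fun r => 7 / 2 * r, fun r hr => ⟨?_, isDirectConstant_seven_halves hr⟩⟩,
    1 / 2, by norm_num, fun r hr C hC => half_mul_le_of_isDirectConstant hr hC⟩
  have hr' : (1 : ℝ) ≤ r := by exact_mod_cast hr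
  linarith
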